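/- Let $\mathcal A=\{0,1,\dots,K-1\}$. A simple Parry substitution is $\varphi:\ \ell\mapsto 0^{\alpha_\ell}(\ell+1)$ for $\ell<K-1$, $K-1\mapsto 0^{\alpha_{K-1}}$, with $\alpha_{K-1}\ge 1$ (and $\alpha_0\ge2$ if $K=1$); put $t=\alpha_0\cdots\alpha_{K-1}000\cdots$. A non-simple Parry substitution is $\varphi:\ \ell\mapsto 0^{\alpha_\ell}(\ell+1)$ for $\ell<K-1$, $K-1\mapsto 0^{\alpha_{K-1}}m$, where $1\le m\le K-1$ and $\alpha_\ell\geq 1$ for some $\ell\ge m$; put $t=\alpha_0\cdots\alpha_{m-1}(\alpha_m\cdots\alpha_{K-1})^\omega$. In both cases the $\alpha_\ell$ are non-negative integers with $\alpha_0\ge1$, $\alpha_\ell\le\alpha_0$, and Parry's condition holds: every proper shift of $t$ is strictly lexicographically smaller than $t$. Let $\mathbf u=u_0u_1\cdots$ be the fixed point of such a $\varphi$, and assume that $\mathbf u$ is $c$-balanced for some $c$: for factors $v,w$ of equal length and every letter $\ell$, $\bigl||v|_\ell-|w|_\ell\bigr|\le c$. Let $\Psi(w)=(|w|_0,\dots,|w|_{K-1})$,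 $\Psi^{\rm rel}(w)=\Psi(w)-\Psi(u_0\cdots u_{|w|-1})$, and let $AC(n)$ be the number of vectors $\Psi(w)$ with $w$ a factor of $\mathbf u$ of length $n$. Let $\mathbf M$ be the matrix with rows $\Psi(\varphi(\ell))$. Let $U_j=|\varphi^j(0)|$, and let $\langle n\rangle_U=d_k\cdots d_0$ be the greedy (normal) representation $n=\sum_j d_jU_j$ of $n\geq 1$, with leading digit $d_k\ne0$. (1) There are integers $H,L\ge0$ such that, for all factors $w$ of $\mathbf u$, the sum of the components of $\Psi^{\rm rel}(w)\mathbf M$ has absolute value at most $H$, and $|w|\ge L$ implies $|\varphi(w)|-|w|\ge2\alpha_0+H$. (2) Fix any such $H,L$, and for $n\ge1$ let $$S(n)=\{(\Psi^{\rm rel}(u_j\cdots u_{j+n-1}),\,u_j,\,u_{j+n-L}\cdots u_{j+n+L})\;:\; j\ge L\}.$$ Then there are an integer $M\geq\alpha_0$, sets $S_0=\emptyset,S_1,\dots,S_M$ of triples and a function $\delta:\{0,\dots,M\}\times\{0,\dots,\alpha_0\}\to\{0,\dots,M\}$ such that every $S(n)$ $(n\ge1)$ is one of $S_1,\dots,S_M$;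 $S_d=S(d)$ and $\delta(0,d)=d$ for $1\le d\le\alpha_0$; $\delta(j,d)\neq0$ for $j\ne0$; and, for $j\neq 0$ and $n,N\ge1$, if $\langle N\rangle_U=\langle n\rangle_U d$ and $S(n)=S_j$, then $S(N)=S_{\delta(j,d)}$. (3) For all such $M$, $S_j$ and $\delta$, put $\mathcal P^{\rm rel}_j=\{\psi : (\psi,a,b)\in S_j\}$ and $\tau(j)=\#\mathcal P^{\rm rel}_j$, and extend $\delta$ to words by $\delta(q,\epsilon)=q$, $\delta(q,xd)=\delta(\delta(q,x),d)$. Then for all $n\ge1$ the digits of $\langle n\rangle_U$ lie in $\{0,\dots,\alpha_0\}$ and $$AC(n)=\tau(\delta(0,\langle n\rangle_U)).$$ The deterministic finite automaton with output with states $\{0,\dots,M\}$, initial state $0$, transition function $\delta$ and output function $\tau$ thus outputs $AC(n)$ on input $\langle n\rangle_U$, and it takes $O(\log n)$ steps (transitions and one output). (4) Hence $(AC(n))_{n\ge1}$ is $U$-automatic: it takes values in a finite alphabet $\Delta$, and it is generated by a deterministic finite automaton with output alphabet $\Delta$ that reads $\langle n\rangle_U$ over the digits $\{0,\dots,\alpha_0\}$.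 -/

import Mathlib

namespace Parry

/-! ### Words, Parikh vectors, balance, abelian complexity -/

/-- The factor `u_j u_{j+1} ⋯ u_{j+n-1}` of the infinite word `u`. -/
def factorAt {A : Type} (u : ℕ → A) (j n : ℕ) : List A :=
  (List.range n).map fun i => u (j + i)

/-- The prefix `u_0 u_1 ⋯ u_{n-1}` of the infinite word `u`. -/
def prefixOf {A : Type} (u : ℕ → A) (n : ℕ) : List A := factorAt u 0 n

/-- The finite word `w` is a factor of the infinite word `u`. -/
def IsFactor {A : Type} (u : ℕ → A) (w : List A) : Prop :=
  ∃ j, w = factorAt u j w.length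

/-- The extension of a substitution to finite words. -/
def applySubst {A : Type} (φ : A → List A) (w : List A) : List A := w.flatMap φ

/-- `u` is a fixed point of the (non-erasing) substitution `φ`: the image of every prefix of `u`
is a prefix of `u`. -/
def IsFixedPoint {A : Type} (φ : A → List A) (u : ℕ → A) : Prop :=
  ∀ n, applySubst φ (prefixOf u n) = prefixOf u (applySubst φ (prefixOf u n)).length

/-- `u` is `c`-balanced. -/
def IsBalanced {K : ℕ} (c : ℕ) (u : ℕ → Fin K) : Prop :=
  ∀ (ℓ : Fin K) (v w : List (Fin K)), IsFactor u v → IsFactor u w → v.length = w.length →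
    |(v.count ℓ : ℤ) - (w.count ℓ : ℤ)| ≤ (c : ℤ)

/-- The Parikh vector `Ψ(w)`. -/
def parikh {K : ℕ} (w : List (Fin K)) : Fin K → ℤ := fun ℓ => (w.count ℓ : ℤ)

/-- The relative Parikh vector `Ψ(w) - Ψ(u_0 ⋯ u_{|w|-1})`. -/
def relParikh {K : ℕ} (u : ℕ → Fin K) (w : List (Fin K)) : Fin K → ℤ :=
  parikh w - parikh (prefixOf u w.length)

/-- The abelian complexity: the number of Parikh vectors of factors of length `n`
(a finite set, since the alphabet is finite). -/
noncomputable def abelianComplexity {K : ℕ} (u : ℕ → Fin K) (n : ℕ) : ℕ :=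
  Set.ncard {ψ : Fin K → ℤ | ∃ w, IsFactor u w ∧ w.length = n ∧ ψ = parikh w}

/-! ### Parry substitutions -/

/-- `0 ↦ 0^{α_0} 1`, `1 ↦ 0^{α_1} 2`, …, `K-2 ↦ 0^{α_{K-2}} (K-1)`, `K-1 ↦ 0^{α_{K-1}}`. -/
def simpleSubst {K : ℕ} [NeZero K] (α : Fin K → ℕ) (ℓ : Fin K) : List (Fin K) :=
  List.replicate (α ℓ) 0 ++ (if h : (ℓ : ℕ) + 1 < K then [⟨(ℓ : ℕ) + 1, h⟩] else [])

/-- `0 ↦ 0^{α_0} 1`, `1 ↦ 0^{α_1} 2`, …, `K-2 ↦ 0^{α_{K-2}} (K-1)`, `K-1 ↦ 0^{α_{K-1}} m`. -/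
def nonSimpleSubst {K : ℕ} [NeZero K] (m : Fin K) (α : Fin K → ℕ) (ℓ : Fin K) : List (Fin K) :=
  List.replicate (α ℓ) 0 ++ (if h : (ℓ : ℕ) + 1 < K then [⟨(ℓ : ℕ) + 1, h⟩] else [m])

/-- The sequence `α_0 α_1 ⋯ α_{K-1} 0 0 0 ⋯`. -/
def simpleExpansion {K : ℕ} (α : Fin K → ℕ) (i : ℕ) : ℕ :=
  if h : i < K then α ⟨i, h⟩ else 0

/-- The sequence `α_0 ⋯ α_{m-1} (α_m ⋯ α_{K-1})^ω`, with preperiod `m` and period `K - m`. -/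
def nonSimpleExpansion {K : ℕ} (m : Fin K) (α : Fin K → ℕ) (i : ℕ) : ℕ :=
  if h : i < K then α ⟨i, h⟩
  else α ⟨(m : ℕ) + (i - (m : ℕ)) % (K - (m : ℕ)), by
    have h1 := m.isLt
    have h2 := Nat.mod_lt (i - (m : ℕ)) (show 0 < K - (m : ℕ) by omega)
    omega⟩

/-- Strict lexicographic order on sequences of natural numbers. -/
def LexLT (s t : ℕ → ℕ) : Prop := ∃ i, (∀ l < i, s l = t l) ∧ s i < t i

/-- Parry's condition, which characterises the Rényi expansions of `1`: every proper shift
of `t` is lexicographically smaller than `t`. -/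
def ParryCondition (t : ℕ → ℕ) : Prop := ∀ j, 1 ≤ j → LexLT (fun i => t (j + i)) t

/-- `φ` is the simple Parry substitution with exponents `α`. For a one-letter alphabet the
identity substitution `0 ↦ 0` is excluded. -/
structure IsSimpleParry {K : ℕ} [NeZero K] (α : Fin K → ℕ) (φ : Fin K → List (Fin K)) : Prop where
  eq : φ = simpleSubst α
  zero_pos : 1 ≤ α 0
  le_zero : ∀ ℓ, α ℓ ≤ α 0
  last_pos : ∀ ℓ : Fin K, (ℓ : ℕ) + 1 = K → 1 ≤ α ℓ
  nondegenerate : K = 1 → 2 ≤ α 0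
  parry : ParryCondition (simpleExpansion α)

/-- `φ` is a non-simple Parry substitution with exponents `α`, on `K = m + p` letters with
`m, p ≥ 1`. -/
def IsNonSimpleParry {K : ℕ} [NeZero K] (α : Fin K → ℕ) (φ : Fin K → List (Fin K)) : Prop :=
  ∃ m : Fin K, 0 < (m : ℕ) ∧ φ = nonSimpleSubst m α ∧ 1 ≤ α 0 ∧ (∀ ℓ, α ℓ ≤ α 0) ∧
    (∃ ℓ, m ≤ ℓ ∧ 1 ≤ α ℓ) ∧ ParryCondition (nonSimpleExpansion m α)

/-- `φ` is a simple or non-simple Parry substitution with exponents `α`. -/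
def IsParrySubst {K : ℕ} [NeZero K] (α : Fin K → ℕ) (φ : Fin K → List (Fin K)) : Prop :=
  IsSimpleParry α φ ∨ IsNonSimpleParry α φ

/-! ### The numeration system -/

/-- `U_j = |φ^j(0)|`. -/
def basis {K : ℕ} [NeZero K] (φ : Fin K → List (Fin K)) (j : ℕ) : ℕ :=
  ((applySubst φ)^[j] [0]).length

/-- The digits `d_k d_{k-1} ⋯ d_0` (in this order) that the greedy algorithm produces from `n`
when it starts at position `k`. -/
def greedyDigits (U : ℕ → ℕ) : ℕ → ℕ → List ℕ
  | 0, n => [n / U 0]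
  | k + 1, n => (n / U (k + 1)) :: greedyDigits U k (n % U (k + 1))

/-- The normal `U`-representation `⟨n⟩_U`, most significant digit first, for a strictly
increasing `U` with `U 0 = 1`: the greedy algorithm started at the greatest `k` with
`U k ≤ n` (such a `k` is at most `n`). The representation of `0` is empty. -/
def normalRep (U : ℕ → ℕ) (n : ℕ) : List ℕ :=
  if n = 0 then [] else greedyDigits U (Nat.findGreatest (fun k => U k ≤ n) n) n

/-! ### Deterministic finite automata with output -/

/-- A deterministic finite automaton with output, with input alphabet `Sig` and output
alphabet `Del`. -/
structure DFAO (Sig Del : Type) where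
  Q : Type
  finite : Finite Q
  δ : Q → Sig → Q
  q₀ : Q
  τ : Q → Del

/-- The run from the state `q` on an input word: the output together with the number of steps,
one for each transition and one for the final output. -/
def DFAO.runFrom {Sig Del : Type} (A : DFAO Sig Del) : A.Q → List Sig → Del × ℕ
  | q, [] => (A.τ q, 1)
  | q, d :: w => ((A.runFrom (A.δ q d) w).1, (A.runFrom (A.δ q d) w).2 + 1)

/-- The output of the automaton on an input word. -/
def DFAO.output {Sig Del : Type} (A : DFAO Sig Del) (w : List Sig) : Del := (A.runFrom A.q₀ w).1

/-- The number of steps of the automaton on an input word. -/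
def DFAO.steps {Sig Del : Type} (A : DFAO Sig Del) (w : List Sig) : ℕ := (A.runFrom A.q₀ w).2

/-- `w` is the normal `U`-representation of `n`, written with the digits `0, …, a`. -/
def IsNormalRep (U : ℕ → ℕ) {a : ℕ} (n : ℕ) (w : List (Fin (a + 1))) : Prop :=
  w.map (fun d => (d : ℕ)) = normalRep U n

/-- The sequence `f 1, f 2, …` takes values in a finite alphabet and is generated by a DFAO
that reads normal `U`-representations over the digits `0, …, a`. -/
def IsUAutomatic (U : ℕ → ℕ) (a : ℕ) (f : ℕ → ℕ) : Prop :=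
  ∃ (Del : Finset ℕ) (A : DFAO (Fin (a + 1)) Del),
    ∀ n, 1 ≤ n → ∃ w : List (Fin (a + 1)), IsNormalRep U n w ∧ f n = A.output w

/-! ### The sets `S(n)` and the transition function -/

/-- The incidence matrix of `φ`. -/
def incidence {K : ℕ} (φ : Fin K → List (Fin K)) : Matrix (Fin K) (Fin K) ℤ :=
  Matrix.of fun i j => ((φ i).count j : ℤ)

/-- `H` bounds `|h_w|` for all factors `w` of `u`, where `h_w` is the sum of the components of
`Ψ^rel(w) M`. -/
def IsBoundH {K : ℕ} (φ : Fin K → List (Fin K)) (u : ℕ → Fin K) (H : ℕ) : Prop :=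
  ∀ w, IsFactor u w → |∑ i, Matrix.vecMul (relParikh u w) (incidence φ) i| ≤ (H : ℤ)

/-- `|φ(w)| - |w| ≥ 2 α_0 + H` for all factors `w` of `u` of length at least `L`
(here `a` is `α_0`). -/
def IsBoundL {K : ℕ} (a : ℕ) (φ : Fin K → List (Fin K)) (u : ℕ → Fin K) (H L : ℕ) : Prop :=
  ∀ w, IsFactor u w → L ≤ w.length → w.length + 2 * a + H ≤ (applySubst φ w).length

/-- Triples `(ψ, a, b_{-L} ⋯ b_L)`. -/
abbrev Triple (K : ℕ) : Type := (Fin K → ℤ) × Fin K × List (Fin K)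

/-- The set `S(n)` of all triples
`(Ψ^rel(u_j ⋯ u_{j+n-1}), u_j, u_{j+n-L} ⋯ u_{j+n+L})` with `j ≥ L`. -/
def setS {K : ℕ} (u : ℕ → Fin K) (L n : ℕ) : Set (Triple K) :=
  {x | ∃ j, L ≤ j ∧
    x = (relParikh u (factorAt u j n), u j, factorAt u (j + n - L) (2 * L + 1))}

/-- The sets `S_0, …, S_M` and the function `δ` on states `0, …, M` and digits `0, …, a`
(where `a` is `α_0`) have the following properties: `S_0 = ∅`; `S_1, …, S_M` are such that each
`S(n)`, `n ≥ 1`, is one of them; `S_d = S(d)` and `δ(0, d) = d` for `d = 1, …, a`; the states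
`1, …, M` are mapped to such states; and if `⟨N⟩_U = ⟨n⟩_U d` and `S(n) = S_j`, then
`S(N) = S_{δ(j, d)}`. -/
structure IsTransition {K : ℕ} [NeZero K] (a : ℕ) (φ : Fin K → List (Fin K)) (u : ℕ → Fin K)
    (L M : ℕ) (S : Fin (M + 1) → Set (Triple K))
    (δ : Fin (M + 1) → Fin (a + 1) → Fin (M + 1)) : Prop where
  le : a ≤ M
  zero : S 0 = ∅
  cover : ∀ n, 1 ≤ n → ∃ j, j ≠ 0 ∧ setS u L n = S j
  digit : ∀ d : Fin (a + 1), d ≠ 0 →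
    S (Fin.castLE (Nat.succ_le_succ le) d) = setS u L (d : ℕ)
  start : ∀ d : Fin (a + 1), d ≠ 0 → δ 0 d = Fin.castLE (Nat.succ_le_succ le) d
  ne_zero : ∀ j d, j ≠ 0 → δ j d ≠ 0
  step : ∀ (n N : ℕ) (d : Fin (a + 1)) (j : Fin (M + 1)), 1 ≤ n → 1 ≤ N → j ≠ 0 →
    normalRep (basis φ) N = normalRep (basis φ) n ++ [(d : ℕ)] →
    setS u L n = S j → setS u L N = S (δ j d)

/-- The set `P^rel_j` of the first components of the elements of `S_j`. -/
def relSet {K M : ℕ} (S : Fin (M + 1) → Set (Triple K)) (j : Fin (M + 1)) : Set (Fin K → ℤ) :=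
  {ψ | ∃ x ∈ S j, ψ = x.1}

/-- The output function `τ(j) = #P^rel_j`. -/
noncomputable def tau {K M : ℕ} (S : Fin (M + 1) → Set (Triple K)) (j : Fin (M + 1)) : ℕ :=
  (relSet S j).ncard

/-- The extension of the transition function to words,
`δ(q, ε) = q` and `δ(q, x d) = δ(δ(q, x), d)`. -/
def deltaStar {M a : ℕ} (δ : Fin (M + 1) → Fin (a + 1) → Fin (M + 1))
    (q : Fin (M + 1)) (w : List (Fin (a + 1))) : Fin (M + 1) := w.foldl δ q

/-- The automaton with states `0, …, M`, transition function `δ`, initial state `0` and output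
function `τ`. -/
noncomputable def abelianDFAO {K M a : ℕ} (S : Fin (M + 1) → Set (Triple K))
    (δ : Fin (M + 1) → Fin (a + 1) → Fin (M + 1)) : DFAO (Fin (a + 1)) ℕ where
  Q := Fin (M + 1)
  finite := inferInstance
  δ := δ
  q₀ := 0
  τ := tau S

end Parry

open Parry

/-! Appending a digit `d` to a normal representation is substitution on prefixes: if ⟨N⟩ = ⟨n⟩d,
then the prefix of length N is φ(prefix of length n) followed by 0^d (`exists_normalRep_eq_append`).
This rests on Parry's condition in the form |φ^k(a)| ≤ U_k for every letter a
(`ParryCondition.le_of_recurrence`): cutting a prefix of φ^k(φ(a)) into blocks φ^k(0) then agrees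
with greedy division by U_k.

A factor of length N starts at some offset e in the image of a letter u_j. Its end differs from the
end of φ(u_j ⋯ u_{j+n-1}) by d + e - h, where h is the sum of the components of Ψ^rel M. Since d, e
≤ α_0 and |h| ≤ H, the new end and its window of radius L lie in the image of the old window, by the
choice of L. Hence the new triple is a function of the old one, d and e (`stepTriple_eq`), and S(N)
is a function of S(n) and d (`setS_eq_stepSet`).

Balance bounds relative Parikh vectors, so only finitely many sets S(n) occur and they can serve as
states (`exists_isTransition`). Recurrence of u makes the restriction j ≥ L harmless, so first
components in S(n) count all Parikh vectors of length n, shifted by a constant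
(`abelianComplexity_eq_ncard`). The step count is logarithmic because U doubles within a bounded
number of indices. -/

namespace Parry

/-! ### Words and images of words -/

section Words

variable {A : Type} (φ : A → List A)

theorem applySubst_append (v w : List A) :
    applySubst φ (v ++ w) = applySubst φ v ++ applySubst φ w := by
  simp [applySubst]

theorem applySubst_singleton (a : A) : applySubst φ [a] = φ a := by
  simp [applySubst]

theorem iterate_applySubst_append (k : ℕ) (v w : List A) :
    (applySubst φ)^[k] (v ++ w) = (applySubst φ)^[k] v ++ (applySubst φ)^[k] w := by
  induction k generalizing v w with
  | zero => rfl
  | succ k ih => simp only [Function.iterate_succ_apply, applySubst_append, ih]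

theorem iterate_applySubst_nil (k : ℕ) : (applySubst φ)^[k] [] = [] := by
  induction k with
  | zero => rfl
  | succ k ih => simpa [Function.iterate_succ_apply, applySubst] using ih

theorem iterate_succ_singleton (k : ℕ) (a : A) :
    (applySubst φ)^[k + 1] [a] = (applySubst φ)^[k] (φ a) := by
  rw [Function.iterate_succ_apply, applySubst_singleton]

theorem length_iterate_replicate (k q : ℕ) (a : A) :
    ((applySubst φ)^[k] (List.replicate q a)).length = q * ((applySubst φ)^[k] [a]).length := by
  induction q with
  | zero => simp [iterate_applySubst_nil]
  | succ q ih =>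
    rw [List.replicate_succ', iterate_applySubst_append, List.length_append, ih]; ring

variable (u : ℕ → A)

@[simp] theorem length_factorAt (j n : ℕ) : (factorAt u j n).length = n := by
  simp [factorAt]

@[simp] theorem length_prefixOf (n : ℕ) : (prefixOf u n).length = n := length_factorAt u 0 n

theorem factorAt_add (j a b : ℕ) :
    factorAt u j (a + b) = factorAt u j a ++ factorAt u (j + a) b := by
  simp [factorAt, List.range_add, Function.comp_def, add_assoc]

theorem prefixOf_add (a b : ℕ) : prefixOf u (a + b) = prefixOf u a ++ factorAt u a b := by
  simp [prefixOf, factorAt_add]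

theorem factorAt_one (j : ℕ) : factorAt u j 1 = [u j] := by simp [factorAt]

theorem take_factorAt (j : ℕ) {a b : ℕ} (h : a ≤ b) :
    (factorAt u j b).take a = factorAt u j a := by
  obtain ⟨c, rfl⟩ := Nat.exists_eq_add_of_le h
  rw [factorAt_add, List.take_left' (length_factorAt _ _ _)]

theorem drop_factorAt (j a b : ℕ) :
    (factorAt u j (a + b)).drop a = factorAt u (j + a) b := by
  rw [factorAt_add, List.drop_left' (length_factorAt _ _ _)]

theorem getD_factorAt (j : ℕ) {e n : ℕ} (h : e < n) (z : A) :
    (factorAt u j n).getD e z = u (j + e) := by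
  simp [factorAt, h]

theorem factorAt_isFactor (j n : ℕ) : IsFactor u (factorAt u j n) :=
  ⟨j, by rw [length_factorAt]⟩

theorem mem_factorAt {j n : ℕ} {a : A} : a ∈ factorAt u j n ↔ ∃ i < n, u (j + i) = a := by
  simp [factorAt]

variable {φ u}

theorem IsFixedPoint.image_factorAt (hu : IsFixedPoint φ u) (j n : ℕ) :
    applySubst φ (factorAt u j n) =
      factorAt u (applySubst φ (prefixOf u j)).length (applySubst φ (factorAt u j n)).length := by
  have h := hu (j + n)
  rw [prefixOf_add, applySubst_append, List.length_append, prefixOf_add, ← hu j] at h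
  exact List.append_cancel_left h

end Words

/-! ### Consequences of the Parry conditions -/

/-- The properties of (simple and non-simple) Parry substitutions that are needed below. -/
structure IsParryLike {K : ℕ} [NeZero K] (α : Fin K → ℕ) (φ : Fin K → List (Fin K)) : Prop where
  shape : ∀ a, ∃ t, φ a = List.replicate (α a) 0 ++ t ∧ t.length ≤ 1
  zero_pos : 1 ≤ α 0
  le_zero : ∀ a, α a ≤ α 0
  -- The only field that needs Parry's condition.
  length_le : ∀ i a, ((applySubst φ)^[i] [a]).length ≤ basis φ i
  two_le : 2 ≤ (φ 0).length
  ne_nil : ∀ a, φ a ≠ []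
  -- This forces every fixed point to begin with 0; `exists_zero` below yields recurrence.
  head : ∀ a, (φ a).head? = some a → a = 0
  exists_zero : ∀ a, ∃ j, (0 : Fin K) ∈ (applySubst φ)^[j] [a]

/-- A comparison principle: lexicographic maximality of `t` bounds all solutions of the
recurrence with coefficients `t` by the one that starts at `0`. -/
theorem ParryCondition.le_of_recurrence {t : ℕ → ℕ} (ht : ParryCondition t) (E : ℕ → ℕ → ℕ)
    (h0 : ∀ s x, E 0 (s + x) ≤ E 0 x)
    (hs : ∀ i s, E (i + 1) s = t s * E i 0 + E i (s + 1)) (i s : ℕ) : E i s ≤ E i 0 := by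
  induction i using Nat.strong_induction_on generalizing s with
  | _ i ih =>
    rcases Nat.eq_zero_or_pos s with rfl | hpos
    · exact le_rfl
    -- `r` is the first index at which the shift by `s` differs from `t`. Up to it the two
    -- expansions are compared term by term.
    obtain ⟨r, hr, hlt⟩ := ht s hpos
    suffices h : ∀ i' x, i' ≤ i → x ≤ r → E i' (s + x) ≤ E i' x from h i 0 le_rfl (Nat.zero_le _)
    intro i'
    induction i' with
    | zero => exact fun x _ _ => h0 s x
    | succ i' ih' =>
      intro x hi hx
      rw [hs, hs]
      rcases hx.lt_or_eq with hx | rfl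
      · have h1 := ih' (x + 1) (by omega) hx
        have h2 := hr x hx
        simp only at h2
        rw [h2]
        exact Nat.add_le_add_left h1 _
      -- At the first difference the larger coefficient supplies a spare copy of `E i' 0`, which
      -- absorbs the remaining term by the outer induction.
      · have h1 := ih i' (by omega) (s + x + 1)
        calc t (s + x) * E i' 0 + E i' (s + x + 1) ≤ t (s + x) * E i' 0 + E i' 0 := by omega
          _ = (t (s + x) + 1) * E i' 0 := by ring
          _ ≤ t x * E i' 0 := Nat.mul_le_mul_right _ hlt
          _ ≤ _ := Nat.le_add_right _ _

theorem length_iterate_succ {K : ℕ} [NeZero K] {φ : Fin K → List (Fin K)} {a : Fin K} {q : ℕ}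
    {t : List (Fin K)} (h : φ a = List.replicate q 0 ++ t) (i : ℕ) :
    ((applySubst φ)^[i + 1] [a]).length = q * basis φ i + ((applySubst φ)^[i] t).length := by
  rw [iterate_succ_singleton, h, iterate_applySubst_append, List.length_append,
    length_iterate_replicate, basis]

theorem IsSimpleParry.isParryLike {K : ℕ} [NeZero K] {α : Fin K → ℕ} {φ : Fin K → List (Fin K)}
    (h : IsSimpleParry α φ) : IsParryLike α φ := by
  obtain ⟨hφ, hpos, hle, hlast, hnd, hP⟩ := h
  have hsh : ∀ a, φ a = List.replicate (α a) 0 ++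
      (if h : (a : ℕ) + 1 < K then [⟨(a : ℕ) + 1, h⟩] else []) := by
    intro a; rw [hφ]; rfl
  have hK : 0 < K := Nat.pos_of_ne_zero (NeZero.ne K)
  have hlast' : ∀ a : Fin K, ¬ (a : ℕ) + 1 < K → 1 ≤ α a := fun a ha =>
    hlast a (by have := a.isLt; omega)
  refine ⟨fun a => ⟨_, hsh a, ?_⟩, hpos, hle, ?_, ?_, ?_, ?_, ?_⟩
  · split_ifs <;> simp
  -- The lengths |φ^i(s)|, extended by 0 beyond the alphabet, satisfy the recurrence because φ(s) =
  -- 0^{α_s}(s+1).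
  · have key := hP.le_of_recurrence
      (fun i s => if h : s < K then ((applySubst φ)^[i] [⟨s, h⟩]).length else 0) ?_ ?_
    · intro i a
      have := key i a
      simpa [a.isLt, hK, basis] using this
    · intro s x
      by_cases h1 : s + x < K
      · have : x < K := by omega
        simp [h1, this]
      · simp [h1]
    · intro i s
      simp only [hK, dif_pos]
      by_cases h1 : s < K
      · simp only [h1, dif_pos, simpleExpansion]
        rw [length_iterate_succ (hsh ⟨s, h1⟩) i]
        congr 1
        by_cases h2 : s + 1 < K <;> simp [h2, iterate_applySubst_nil]
      · have h2 : ¬ s + 1 < K := by omega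
        simp [h1, h2, simpleExpansion]
  · rw [hsh]
    by_cases h1 : K = 1
    · have := hnd h1
      simp; omega
    · have : 1 < K := by omega
      simp [this]; omega
  · intro a ha
    rw [hsh] at ha
    by_cases h1 : (a : ℕ) + 1 < K
    · simp [h1] at ha
    · have := hlast' a h1
      simp [h1] at ha; omega
  · intro a ha
    rw [hsh] at ha
    rcases Nat.eq_zero_or_pos (α a) with h0 | h0
    · by_cases h1 : (a : ℕ) + 1 < K
      · simp [h0, h1, Fin.ext_iff] at ha
      · have := hlast' a h1
        omega
    · obtain ⟨q, hq⟩ := Nat.exists_eq_succ_of_ne_zero h0.ne'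
      rw [hq] at ha
      simpa [List.replicate_succ, eq_comm] using ha
  · have : ∀ p (a : Fin K), (a : ℕ) + p = K → ∃ j, (0 : Fin K) ∈ (applySubst φ)^[j] [a] := by
      intro p
      induction p with
      | zero => intro a ha; have := a.isLt; omega
      | succ p ih =>
        intro a ha
        rcases Nat.eq_zero_or_pos (α a) with h0 | h0
        · by_cases h1 : (a : ℕ) + 1 < K
          · obtain ⟨j, hj⟩ := ih ⟨a + 1, h1⟩ (by simp; omega)
            refine ⟨j + 1, ?_⟩
            rw [iterate_succ_singleton, hsh]
            simpa [h0, h1] using hj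
          · have := hlast' a h1
            omega
        · refine ⟨1, ?_⟩
          rw [Function.iterate_one, applySubst_singleton, hsh]
          simp [h0.ne']
    intro a
    exact this (K - a) a (by have := a.isLt; omega)

theorem IsNonSimpleParry.isParryLike {K : ℕ} [NeZero K] {α : Fin K → ℕ}
    {φ : Fin K → List (Fin K)} (h : IsNonSimpleParry α φ) : IsParryLike α φ := by
  obtain ⟨m, hm, hφ, hpos, hle, ⟨l, hml, hl⟩, hP⟩ := h
  have hsh : ∀ a, φ a = List.replicate (α a) 0 ++
      (if h : (a : ℕ) + 1 < K then [⟨(a : ℕ) + 1, h⟩] else [m]) := by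
    intro a; rw [hφ]; rfl
  have hK : 0 < K := Nat.pos_of_ne_zero (NeZero.ne K)
  have hm' := m.isLt
  -- Letters up to `l` either produce a 0 or climb to `l`, whose image contains 0. For later
  -- letters, `hwrap` also allows the passage from K-1 back to m ≤ l.
  have hstep : ∀ p (a : Fin K), (a : ℕ) + p = l → ∃ j, (0 : Fin K) ∈ (applySubst φ)^[j] [a] := by
    intro p
    induction p with
    | zero =>
      intro a ha
      obtain rfl : a = l := Fin.ext ha
      refine ⟨1, ?_⟩
      rw [Function.iterate_one, applySubst_singleton, hsh]
      simp [show α a ≠ 0 by omega]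
    | succ p ih =>
      intro a ha
      rcases Nat.eq_zero_or_pos (α a) with h0 | h0
      · have h1 : (a : ℕ) + 1 < K := by have := l.isLt; omega
        obtain ⟨j, hj⟩ := ih ⟨a + 1, h1⟩ (by simp; omega)
        refine ⟨j + 1, ?_⟩
        rw [iterate_succ_singleton, hsh]
        simpa [h0, h1] using hj
      · refine ⟨1, ?_⟩
        rw [Function.iterate_one, applySubst_singleton, hsh]
        simp [h0.ne']
  have hwrap : ∀ p (a : Fin K), (a : ℕ) + p = K → ∃ j, (0 : Fin K) ∈ (applySubst φ)^[j] [a] := by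
    intro p
    induction p with
    | zero => intro a ha; have := a.isLt; omega
    | succ p ih =>
      intro a ha
      rcases Nat.eq_zero_or_pos (α a) with h0 | h0
      · by_cases h1 : (a : ℕ) + 1 < K
        · obtain ⟨j, hj⟩ := ih ⟨a + 1, h1⟩ (by simp; omega)
          refine ⟨j + 1, ?_⟩
          rw [iterate_succ_singleton, hsh]
          simpa [h0, h1] using hj
        · obtain ⟨j, hj⟩ := hstep (l - m) m (by have : (m : ℕ) ≤ l := hml; omega)
          refine ⟨j + 1, ?_⟩
          rw [iterate_succ_singleton, hsh]
          simpa [h0, h1] using hj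
      · refine ⟨1, ?_⟩
        rw [Function.iterate_one, applySubst_singleton, hsh]
        simp [h0.ne']
  refine ⟨fun a => ⟨_, hsh a, ?_⟩, hpos, hle, ?_, ?_, ?_, ?_, ?_⟩
  · split_ifs <;> simp
  -- Indices beyond the alphabet are folded onto the period, so that the successor of K-1 is m, as
  -- in φ.
  · have hidx : ∀ s, (if s < K then s else (m : ℕ) + (s - m) % (K - m)) < K := by
      intro s
      have h2 := Nat.mod_lt (s - (m : ℕ)) (show 0 < K - (m : ℕ) by omega)
      split_ifs <;> omega
    have ht : ∀ s, nonSimpleExpansion m α s = α ⟨_, hidx s⟩ := by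
      intro s
      unfold nonSimpleExpansion
      by_cases h1 : s < K <;> simp [h1]
    have key := hP.le_of_recurrence
      (fun i s => ((applySubst φ)^[i] [⟨_, hidx s⟩]).length) ?_ ?_
    · intro i a
      have := key i a
      simpa [a.isLt, hK, basis] using this
    · intro s x
      simp
    · intro i s
      rw [length_iterate_succ (hsh _) i, ht]
      congr 1
      · congr 2
        simp [hK, basis]
      · congr 2
        by_cases h1 : s + 1 < K
        · have h2 : s < K := by omega
          simp [h1, h2]
        by_cases h2 : s < K
        · have h3 : s + 1 = K := by omega
          simp [h2, h3]
        · have h4 := Nat.mod_lt (s - (m : ℕ)) (show 0 < K - (m : ℕ) by omega)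
          have h5 : (s + 1 - m) % (K - (m : ℕ)) = ((s - m) % (K - (m : ℕ)) + 1) % (K - (m : ℕ)) := by
            rw [Nat.mod_add_mod, show s + 1 - m = s - m + 1 by omega]
          rcases (show (s - m) % (K - (m : ℕ)) + 1 < K - (m : ℕ) ∨ (s - m) % (K - (m : ℕ)) + 1 = K - (m : ℕ) by omega) with h6 | h6
          · rw [Nat.mod_eq_of_lt h6] at h5
            have h7 : (m : ℕ) + (s - m) % (K - (m : ℕ)) + 1 < K := by omega
            simp [h1, h2, h5, h7, ← Nat.add_assoc]
          · rw [h6, Nat.mod_self] at h5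
            have h7 : ¬ (m : ℕ) + (s - m) % (K - (m : ℕ)) + 1 < K := by omega
            simp [h1, h2, h5, h7]
  · rw [hsh]
    have : 1 < K := by omega
    simp [this]; omega
  · intro a ha
    rw [hsh] at ha
    by_cases h1 : (a : ℕ) + 1 < K <;> simp [h1] at ha
  · intro a ha
    rw [hsh] at ha
    rcases Nat.eq_zero_or_pos (α a) with h0 | h0
    · by_cases h1 : (a : ℕ) + 1 < K
      · simp [h0, h1, Fin.ext_iff] at ha
      · simp [h0, h1] at ha
        subst ha
        -- Only φ(K-1) = K-1 = m could violate the claim. Then l ≥ m leaves l = K-1, whose exponent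
        -- is positive.
        have : m = l := Fin.ext (by have : (m : ℕ) ≤ l := hml; have := l.isLt; omega)
        subst this
        omega
    · obtain ⟨q, hq⟩ := Nat.exists_eq_succ_of_ne_zero h0.ne'
      rw [hq] at ha
      simpa [List.replicate_succ, eq_comm] using ha
  · intro a
    exact hwrap (K - a) a (by have := a.isLt; omega)

theorem IsParrySubst.isParryLike {K : ℕ} [NeZero K] {α : Fin K → ℕ} {φ : Fin K → List (Fin K)}
    (h : IsParrySubst α φ) : IsParryLike α φ :=
  h.elim IsSimpleParry.isParryLike IsNonSimpleParry.isParryLike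

/-! ### Greedy digits -/

/-- The `k` least significant greedy digits of `n`, most significant digit first. -/
def lowDigits (U : ℕ → ℕ) : ℕ → ℕ → List ℕ
  | 0, _ => []
  | k + 1, n => (n / U k) :: lowDigits U k (n % U k)

theorem greedyDigits_eq_lowDigits (U : ℕ → ℕ) (k n : ℕ) :
    greedyDigits U k n = lowDigits U (k + 1) n := by
  induction k generalizing n with
  | zero => rfl
  | succ k ih => rw [greedyDigits, ih]; rfl

theorem length_lowDigits (U : ℕ → ℕ) (k n : ℕ) : (lowDigits U k n).length = k := by
  induction k generalizing n with
  | zero => rfl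
  | succ k ih => rw [lowDigits, List.length_cons, ih]

theorem lowDigits_injOn {U : ℕ → ℕ} (h0 : U 0 = 1) (hpos : ∀ k, 0 < U k) {k n n' : ℕ}
    (hn : n < U k) (hn' : n' < U k) (h : lowDigits U k n = lowDigits U k n') : n = n' := by
  induction k generalizing n n' with
  | zero => omega
  | succ k ih =>
    rw [lowDigits, lowDigits, List.cons.injEq] at h
    have h2 := ih (Nat.mod_lt _ (hpos k)) (Nat.mod_lt _ (hpos k)) h.2
    rw [← Nat.div_add_mod n (U k), ← Nat.div_add_mod n' (U k), h.1, h2]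

theorem normalRep_eq_lowDigits {U : ℕ → ℕ} (hU : StrictMono U) {k n : ℕ} (h1 : U k ≤ n)
    (h2 : n < U (k + 1)) (hn : 1 ≤ n) : normalRep U n = lowDigits U (k + 1) n := by
  have hk : Nat.findGreatest (fun k => U k ≤ n) n = k := by
    refine (Nat.findGreatest_eq_iff).2 ⟨hU.le_apply.trans h1, fun _ => h1, ?_⟩
    intro l hl _ hle
    exact absurd (hU.monotone (show k + 1 ≤ l from hl)) (by omega)
  rw [normalRep, if_neg (by omega), hk, greedyDigits_eq_lowDigits]

theorem exists_basis_le_lt {U : ℕ → ℕ} (hU : StrictMono U) (h0 : U 0 = 1) {n : ℕ} (hn : 1 ≤ n) :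
    ∃ k, U k ≤ n ∧ n < U (k + 1) := by
  classical
  have hex : ∃ k, n < U k := ⟨n + 1, lt_of_lt_of_le (Nat.lt_succ_self n) hU.le_apply⟩
  have hs := Nat.find_spec hex
  have h0' : Nat.find hex ≠ 0 := by
    intro h; rw [h] at hs; omega
  obtain ⟨k, hk⟩ := Nat.exists_eq_succ_of_ne_zero h0'
  rw [hk] at hs
  refine ⟨k, ?_, hs⟩
  exact not_lt.1 (Nat.find_min hex (show k < Nat.find hex by omega))

theorem normalRep_injective {U : ℕ → ℕ} (hU : StrictMono U) (h0 : U 0 = 1) :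
    Function.Injective (normalRep U) := by
  have hpos : ∀ k, 0 < U k := fun k => by
    have := hU.monotone (Nat.zero_le k); omega
  have hlen : ∀ n, 1 ≤ n → ∃ k, n < U (k + 1) ∧ normalRep U n = lowDigits U (k + 1) n := by
    intro n hn
    obtain ⟨k, h1, h2⟩ := exists_basis_le_lt hU h0 hn
    exact ⟨k, h2, normalRep_eq_lowDigits hU h1 h2 hn⟩
  intro n n' h
  rcases Nat.eq_zero_or_pos n with rfl | hn <;> rcases Nat.eq_zero_or_pos n' with rfl | hn'
  · rfl
  · obtain ⟨k, -, h2⟩ := hlen n' hn'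
    rw [h2] at h
    simp [normalRep, lowDigits] at h
  · obtain ⟨k, -, h2⟩ := hlen n hn
    rw [h2] at h
    simp [normalRep, lowDigits] at h
  · obtain ⟨k, h1, h2⟩ := hlen n hn
    obtain ⟨k', h1', h2'⟩ := hlen n' hn'
    rw [h2, h2'] at h
    have hk : k = k' := by simpa [length_lowDigits] using congrArg List.length h
    subst hk
    exact lowDigits_injOn h0 hpos h1 h1' h

/-! ### Lengths and prefixes -/

section

variable {K : ℕ} [NeZero K] {α : Fin K → ℕ} {φ : Fin K → List (Fin K)}

theorem basis_zero : basis φ 0 = 1 := rfl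

namespace IsParryLike

/-- No image is empty and φ(0) has at least two letters, so each 0 contributes at least one extra
letter. -/
theorem length_add_count_le (h : IsParryLike α φ) (w : List (Fin K)) :
    w.length + w.count 0 ≤ (applySubst φ w).length := by
  induction w with
  | nil => simp
  | cons a w ih =>
    have h1 : applySubst φ (a :: w) = φ a ++ applySubst φ w := by simp [applySubst]
    rw [h1, List.length_append, List.length_cons, List.count_cons]
    by_cases ha : a = 0
    · subst ha
      have := h.two_le
      simp; omega
    · have := List.length_pos_of_ne_nil (h.ne_nil a)
      simp [ha]; omega

theorem length_le_image (h : IsParryLike α φ) (w : List (Fin K)) :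
    w.length ≤ (applySubst φ w).length :=
  (Nat.le_add_right _ _).trans (h.length_add_count_le w)

theorem apply_zero (h : IsParryLike α φ) {u : ℕ → Fin K} (hu : IsFixedPoint φ u) : u 0 = 0 := by
  have h1 := hu 1
  have h2 : prefixOf u 1 = [u 0] := factorAt_one u 0
  rw [h2, applySubst_singleton] at h1
  apply h.head
  rw [h1]
  obtain ⟨l, hl⟩ := Nat.exists_eq_succ_of_ne_zero
    (List.length_pos_of_ne_nil (h.ne_nil (u 0))).ne'
  rw [hl, Nat.succ_eq_one_add, prefixOf_add, h2]
  rfl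

theorem iterate_zero_eq_prefixOf (h : IsParryLike α φ) {u : ℕ → Fin K} (hu : IsFixedPoint φ u)
    (k : ℕ) : (applySubst φ)^[k] [0] = prefixOf u (basis φ k) := by
  induction k with
  | zero =>
    have := factorAt_one u 0
    rw [h.apply_zero hu] at this
    exact this.symm
  | succ k ih =>
    rw [basis, Function.iterate_succ_apply', ih]
    exact hu _

theorem exists_mem_zero (h : IsParryLike α φ) (k : ℕ) : (0 : Fin K) ∈ (applySubst φ)^[k] [0] := by
  induction k with
  | zero => simp
  | succ k ih =>
    rw [Function.iterate_succ_apply', applySubst, List.mem_flatMap]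
    refine ⟨0, ih, ?_⟩
    obtain ⟨t, ht, -⟩ := h.shape 0
    rw [ht]
    have := h.zero_pos
    simp; omega

theorem basis_strictMono (h : IsParryLike α φ) : StrictMono (basis φ) := by
  refine strictMono_nat_of_lt_succ fun k => ?_
  have h1 := h.length_add_count_le ((applySubst φ)^[k] [0])
  have h2 := List.count_pos_iff.2 (h.exists_mem_zero k)
  rw [basis, basis, Function.iterate_succ_apply']
  omega

theorem basis_pos (h : IsParryLike α φ) (k : ℕ) : 0 < basis φ k := by
  have := h.basis_strictMono.monotone (Nat.zero_le k)
  rw [basis_zero] at this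
  omega

theorem length_image_letter_le (h : IsParryLike α φ) (a : Fin K) : (φ a).length ≤ α 0 + 1 := by
  obtain ⟨t, ht, ht'⟩ := h.shape a
  have := h.le_zero a
  rw [ht]; simp; omega

/-- A proper prefix of `φ^k(φ(a))` passes through `⌊n / U_k⌋` blocks `φ^k(0)`. -/
theorem exists_block (h : IsParryLike α φ) (k : ℕ) (a : Fin K) {n : ℕ}
    (hn : n < ((applySubst φ)^[k] (φ a)).length) :
    ∃ b t, φ a = List.replicate (n / basis φ k) 0 ++ b :: t ∧
      n % basis φ k < ((applySubst φ)^[k] [b]).length := by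
  have hpos := h.basis_pos k
  obtain ⟨t, ht, ht1⟩ := h.shape a
  rw [ht, iterate_applySubst_append, List.length_append, length_iterate_replicate] at hn
  change n < α a * basis φ k + _ at hn
  rcases lt_or_ge (n / basis φ k) (α a) with hq | hq
  · obtain ⟨r, hr⟩ := Nat.exists_eq_add_of_lt hq
    refine ⟨0, List.replicate r 0 ++ t, ?_, Nat.mod_lt _ hpos⟩
    rw [ht, ← List.cons_append, ← List.replicate_succ, ← List.append_assoc,
      ← List.replicate_add, hr, Nat.add_assoc]
  · have h1 : α a * basis φ k ≤ n := (Nat.le_div_iff_mul_le hpos).1 hq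
    match t, ht1 with
    | [], _ => simp [iterate_applySubst_nil] at hn; omega
    | [b], _ =>
      -- The tail block is no longer than U_k, so the quotient cannot exceed α_a.
      have hb := h.length_le k b
      have hq' : n / basis φ k = α a := by
        apply le_antisymm _ hq
        rw [← Nat.lt_succ_iff, Nat.div_lt_iff_lt_mul hpos, Nat.succ_mul]
        omega
      refine ⟨b, [], by rw [ht, hq'], ?_⟩
      have := Nat.div_add_mod n (basis φ k)
      rw [hq', Nat.mul_comm] at this
      omega
    | _ :: _ :: _, h2 => simp at h2

/-- Removing the last greedy digit corresponds to desubstituting a prefix of `φ^{k+1}(a)`. -/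
theorem exists_desubst (h : IsParryLike α φ) (k : ℕ) (a : Fin K) {n : ℕ}
    (hn : n < ((applySubst φ)^[k + 1] [a]).length) :
    ∃ n' d, n' < ((applySubst φ)^[k] [a]).length ∧ d ≤ α 0 ∧
      lowDigits (basis φ) (k + 1) n = lowDigits (basis φ) k n' ++ [d] ∧
      ((applySubst φ)^[k + 1] [a]).take n =
        applySubst φ (((applySubst φ)^[k] [a]).take n') ++ List.replicate d 0 := by
  induction k generalizing a n with
  | zero =>
    obtain ⟨b, t, hb, -⟩ := h.exists_block 0 a (by rwa [iterate_succ_singleton] at hn)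
    rw [basis_zero, Nat.div_one] at hb
    refine ⟨0, n, by simp, ?_, ?_, ?_⟩
    · have h1 := h.length_image_letter_le a
      rw [hb] at h1
      simp at h1; omega
    · simp [lowDigits, basis_zero]
    · rw [iterate_succ_singleton, Function.iterate_zero_apply, hb,
        List.take_left' List.length_replicate]
      simp [applySubst]
  | succ k ih =>
    rw [iterate_succ_singleton] at hn ⊢
    obtain ⟨b, t, hb, hr⟩ := h.exists_block (k + 1) a hn
    obtain ⟨r', d, hr', hd, hdig, htake⟩ := ih b hr
    set q := n / basis φ (k + 1) with hq
    have hpos := h.basis_pos k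
    have hrU : r' < basis φ k := hr'.trans_le (h.length_le k b)
    have hsplit : ∀ i, (applySubst φ)^[i] (φ a) = (applySubst φ)^[i] (List.replicate q 0) ++
        ((applySubst φ)^[i] [b] ++ (applySubst φ)^[i] t) := by
      intro i
      rw [hb, iterate_applySubst_append, ← List.singleton_append (l := t),
        iterate_applySubst_append]
    have htk : ∀ i r, r < ((applySubst φ)^[i] [b]).length →
        ((applySubst φ)^[i] (φ a)).take (q * basis φ i + r) =
          (applySubst φ)^[i] (List.replicate q 0) ++ ((applySubst φ)^[i] [b]).take r := by
      intro i r hr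
      rw [hsplit, List.take_append, List.take_of_length_le, List.take_append_of_le_length]
      · congr 2
        rw [length_iterate_replicate, basis]; omega
      · rw [length_iterate_replicate, basis]; omega
      · rw [length_iterate_replicate, basis]; omega
    -- The same `q` full blocks are kept one level lower. Since r' < U_k, greedy division recovers
    -- `q` and `r'`.
    refine ⟨q * basis φ k + r', d, ?_, hd, ?_, ?_⟩
    · rw [hsplit, List.length_append, List.length_append,
        length_iterate_replicate]
      change _ < q * basis φ k + _
      omega
    · have h1 : (q * basis φ k + r') / basis φ k = q := by
        rw [Nat.add_comm, Nat.add_mul_div_right _ _ hpos, Nat.div_eq_of_lt hrU, Nat.zero_add]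
      have h2 : (q * basis φ k + r') % basis φ k = r' := by
        rw [Nat.add_comm, Nat.add_mul_mod_self_right, Nat.mod_eq_of_lt hrU]
      rw [lowDigits, hdig, ← hq, lowDigits, h1, h2, List.cons_append]
    · rw [iterate_succ_singleton, htk k r' hr', applySubst_append, List.append_assoc, ← htake,
        ← Function.iterate_succ_apply' (applySubst φ), ← htk (k + 1) _ hr, hq, Nat.mul_comm,
        Nat.div_add_mod]

/-- Removing the last digit of a normal representation. -/
theorem exists_normalRep_eq_append (h : IsParryLike α φ) {u : ℕ → Fin K} (hu : IsFixedPoint φ u)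
    {N : ℕ} (hN : 1 ≤ N) :
    ∃ n d, n < N ∧ d ≤ α 0 ∧ normalRep (basis φ) N = normalRep (basis φ) n ++ [d] ∧
      prefixOf u N = applySubst φ (prefixOf u n) ++ List.replicate d 0 := by
  obtain ⟨k, hk, hk'⟩ := exists_basis_le_lt h.basis_strictMono basis_zero hN
  obtain ⟨n, d, hn, hd, hdig, htake⟩ := h.exists_desubst k 0 hk'
  have hrep := normalRep_eq_lowDigits h.basis_strictMono hk hk' hN
  change n < basis φ k at hn
  rw [h.iterate_zero_eq_prefixOf hu, h.iterate_zero_eq_prefixOf hu, prefixOf,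
    take_factorAt _ _ hk'.le, prefixOf, take_factorAt _ _ hn.le] at htake
  refine ⟨n, d, by omega, hd, ?_, htake⟩
  rw [hrep, hdig]
  congr 1
  cases k with
  | zero =>
    rw [basis_zero] at hn
    obtain rfl : n = 0 := by omega
    simp [lowDigits, normalRep]
  | succ k =>
    -- `n` inherits the nonzero leading digit of `N`, so its digit string has no leading zero and is
    -- the normal representation.
    have h1 : basis φ k ≤ n := by
      rw [lowDigits, show lowDigits (basis φ) (k + 1) n = n / basis φ k ::
        lowDigits (basis φ) k (n % basis φ k) from rfl, List.cons_append, List.cons.injEq] at hdig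
      have h2 : 0 < N / basis φ (k + 1) := Nat.div_pos hk (h.basis_pos _)
      rw [hdig.1] at h2
      exact (Nat.div_pos_iff.1 h2).2
    exact (normalRep_eq_lowDigits h.basis_strictMono h1 hn (by have := h.basis_pos k; omega)).symm

/-- Injectivity of normal representations identifies the given `n` and `d` with those obtained by
desubstitution. -/
theorem prefixOf_eq_of_normalRep (h : IsParryLike α φ) {u : ℕ → Fin K} (hu : IsFixedPoint φ u)
    {n N d : ℕ} (hN : 1 ≤ N)
    (hrep : normalRep (basis φ) N = normalRep (basis φ) n ++ [d]) :
    d ≤ α 0 ∧ prefixOf u N = applySubst φ (prefixOf u n) ++ List.replicate d 0 := by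
  obtain ⟨n', d', -, hd, h1, h2⟩ := h.exists_normalRep_eq_append hu hN
  rw [hrep] at h1
  obtain ⟨h3, h4⟩ := List.append_inj' h1 rfl
  obtain rfl := normalRep_injective h.basis_strictMono basis_zero h3
  obtain rfl : d = d' := by simpa using h4
  exact ⟨hd, h2⟩

/-! ### Recurrence -/

theorem exists_iterate_eq_factorAt (h : IsParryLike α φ) {u : ℕ → Fin K} (hu : IsFixedPoint φ u)
    (j n k : ℕ) : ∃ i, j ≤ i ∧
      (applySubst φ)^[k] (factorAt u j n) =
        factorAt u i ((applySubst φ)^[k] (factorAt u j n)).length := by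
  induction k with
  | zero => exact ⟨j, le_rfl, by simp⟩
  | succ k ih =>
    obtain ⟨i, hi, hi'⟩ := ih
    refine ⟨(applySubst φ (prefixOf u i)).length, ?_, ?_⟩
    · have := h.length_le_image (prefixOf u i)
      rw [length_prefixOf] at this
      omega
    · rw [Function.iterate_succ_apply', hi']
      exact hu.image_factorAt _ _

theorem exists_eq_zero_ge (h : IsParryLike α φ) {u : ℕ → Fin K} (hu : IsFixedPoint φ u) (B : ℕ) :
    ∃ i, B ≤ i ∧ u i = 0 := by
  obtain ⟨j, hj⟩ := h.exists_zero (u B)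
  obtain ⟨i, hi, hi'⟩ := h.exists_iterate_eq_factorAt hu B 1 j
  rw [factorAt_one] at hi'
  rw [hi', mem_factorAt] at hj
  obtain ⟨l, -, hl⟩ := hj
  exact ⟨i + l, by omega, hl⟩

/-- Every factor of `u` occurs infinitely often. -/
theorem recurrent (h : IsParryLike α φ) {u : ℕ → Fin K} (hu : IsFixedPoint φ u) (i n B : ℕ) :
    ∃ j, B ≤ j ∧ factorAt u j n = factorAt u i n := by
  -- The iterates of a late 0 reproduce, at a late position, a prefix of u long enough to contain
  -- the factor.
  obtain ⟨z, hz, hz0⟩ := h.exists_eq_zero_ge hu B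
  obtain ⟨j, hj, hj'⟩ := h.exists_iterate_eq_factorAt hu z 1 (i + n)
  rw [factorAt_one, hz0, h.iterate_zero_eq_prefixOf hu, length_prefixOf] at hj'
  have hle : i + n ≤ basis φ (i + n) := h.basis_strictMono.le_apply
  refine ⟨j + i, by omega, ?_⟩
  have h1 := congrArg (List.take (i + n)) hj'
  rw [prefixOf, take_factorAt _ _ hle, take_factorAt _ _ hle] at h1
  have h2 := congrArg (List.drop i) h1
  rwa [drop_factorAt, drop_factorAt, Nat.zero_add, eq_comm] at h2

theorem exists_count_zero_ge (h : IsParryLike α φ) {u : ℕ → Fin K} (hu : IsFixedPoint φ u)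
    (m : ℕ) : ∃ l, ∀ n, l ≤ n → m ≤ (prefixOf u n).count 0 := by
  induction m with
  | zero => exact ⟨0, fun _ _ => Nat.zero_le _⟩
  | succ m ih =>
    obtain ⟨l, hl⟩ := ih
    obtain ⟨i, hi, hi0⟩ := h.exists_eq_zero_ge hu l
    refine ⟨i + 1, fun n hn => ?_⟩
    obtain ⟨r, rfl⟩ := Nat.exists_eq_add_of_le hn
    rw [prefixOf_add, prefixOf_add, factorAt_one, hi0]
    have := hl i hi
    simp; omega

end IsParryLike

end

/-! ### Parikh vectors -/

section

variable {K : ℕ} {φ : Fin K → List (Fin K)} {u : ℕ → Fin K}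

theorem parikh_append (v w : List (Fin K)) : parikh (v ++ w) = parikh v + parikh w := by
  ext i; simp [parikh]

theorem sum_parikh (w : List (Fin K)) : ∑ i, parikh w i = (w.length : ℤ) := by
  induction w with
  | nil => simp [parikh]
  | cons a w ih =>
    rw [← List.singleton_append, parikh_append]
    simp only [Pi.add_apply, Finset.sum_add_distrib, ih]
    simp [parikh, List.count_singleton, add_comm]

theorem parikh_applySubst (w : List (Fin K)) :
    parikh (applySubst φ w) = Matrix.vecMul (parikh w) (incidence φ) := by
  induction w with
  | nil =>
    ext i
    simp [parikh, applySubst, Matrix.vecMul, dotProduct]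
  | cons a w ih =>
    rw [← List.singleton_append, parikh_append, applySubst_append, parikh_append, ih,
      Matrix.add_vecMul, applySubst_singleton]
    congr 1
    ext i
    simp [parikh, Matrix.vecMul, dotProduct, incidence, List.count_singleton]

theorem parikh_factorAt (j n : ℕ) :
    parikh (factorAt u j n) = parikh (prefixOf u (j + n)) - parikh (prefixOf u j) := by
  rw [prefixOf_add, parikh_append, add_sub_cancel_left]

theorem relParikh_factorAt (j n : ℕ) :
    relParikh u (factorAt u j n) =
      parikh (prefixOf u (j + n)) - parikh (prefixOf u j) - parikh (prefixOf u n) := by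
  rw [relParikh, length_factorAt, parikh_factorAt]

theorem abs_relParikh_le {c : ℕ} (hc : IsBalanced c u) (j n : ℕ) (i : Fin K) :
    |relParikh u (factorAt u j n) i| ≤ c := by
  have := hc i (factorAt u j n) (prefixOf u n) (factorAt_isFactor u j n) (factorAt_isFactor u 0 n)
    (by simp)
  simpa [relParikh, parikh] using this

/-- Balance bounds each component of Ψ^rel by c, and the matrix entries are non-negative. -/
theorem exists_isBoundH {c : ℕ} (hc : IsBalanced c u) : ∃ H, IsBoundH φ u H := by
  refine ⟨(∑ i, ∑ l, (c : ℤ) * incidence φ l i).toNat, fun w hw => ?_⟩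
  obtain ⟨j, hj⟩ := hw
  have hnn : ∀ l i, 0 ≤ incidence φ l i := fun l i => by simp [incidence]
  refine le_trans ?_ (Int.self_le_toNat _)
  refine (Finset.abs_sum_le_sum_abs _ _).trans (Finset.sum_le_sum fun i _ => ?_)
  rw [Matrix.vecMul, dotProduct]
  refine (Finset.abs_sum_le_sum_abs _ _).trans (Finset.sum_le_sum fun l _ => ?_)
  rw [abs_mul, abs_of_nonneg (hnn l i)]
  refine mul_le_mul_of_nonneg_right ?_ (hnn l i)
  rw [hj]
  exact abs_relParikh_le hc _ _ _

/-- |φ(w)| - |w| is at least the number of zeros in w. By balance this is within c of the count in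
the prefix, which is unbounded. -/
theorem IsParryLike.exists_isBoundL [NeZero K] {α : Fin K → ℕ} (h : IsParryLike α φ)
    (hu : IsFixedPoint φ u) {c : ℕ} (hc : IsBalanced c u) (H : ℕ) :
    ∃ L, IsBoundL (α 0) φ u H L := by
  obtain ⟨L, hL⟩ := h.exists_count_zero_ge hu (2 * α 0 + H + c)
  refine ⟨L, fun w hw hwL => ?_⟩
  have h1 := hc 0 w (prefixOf u w.length) hw (factorAt_isFactor u 0 _) (by simp)
  have h2 := hL _ hwL
  have h3 := h.length_add_count_le w
  rw [abs_le] at h1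
  omega

/-! ### The action of the substitution on triples -/

/-- The triple of the occurrence of a factor with desubstituted triple `x`, starting at offset
`e` in the image of the first letter, when `d` is the last digit of the length. -/
def stepTriple [NeZero K] (φ : Fin K → List (Fin K)) (L d e : ℕ) (x : Triple K) : Triple K :=
  let W := applySubst φ x.2.2
  let V := applySubst φ (x.2.2.take L)
  -- `q` is the end of the new factor, measured from the start of the image of the window; `V` ends
  -- where φ of the old factor ends. Under the bounds on `H` and `L` the integer is non-negative, so
  -- `toNat` loses nothing.
  let q := ((V.length : ℤ) + d + e - ∑ i, Matrix.vecMul x.1 (incidence φ) i).toNat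
  (Matrix.vecMul x.1 (incidence φ) + parikh (W.take q) - parikh V - parikh ((φ x.2.1).take e) -
    parikh (List.replicate d 0), (φ x.2.1).getD e 0, (W.drop (q - L)).take (2 * L + 1))

/-- The set of all triples that `stepTriple` produces from the triples in `X`. -/
def stepSet [NeZero K] (φ : Fin K → List (Fin K)) (L d : ℕ) (X : Set (Triple K)) :
    Set (Triple K) :=
  {y | ∃ x ∈ X, ∃ e < (φ x.2.1).length, y = stepTriple φ L d e x}

theorem vecMul_relParikh (hu : IsFixedPoint φ u) (j n : ℕ) :
    Matrix.vecMul (relParikh u (factorAt u j n)) (incidence φ) =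
      parikh (prefixOf u (applySubst φ (prefixOf u (j + n))).length) -
        parikh (prefixOf u (applySubst φ (prefixOf u j)).length) -
        parikh (prefixOf u (applySubst φ (prefixOf u n)).length) := by
  rw [relParikh_factorAt, Matrix.sub_vecMul, Matrix.sub_vecMul, ← parikh_applySubst,
    ← parikh_applySubst, ← parikh_applySubst, ← hu, ← hu, ← hu]

theorem stepTriple_eq [NeZero K] (hu : IsFixedPoint φ u) {a H L : ℕ} (hH : IsBoundH φ u H)
    (hL : IsBoundL a φ u H L) {n N d j e : ℕ} (hd : d ≤ a)
    (hN : prefixOf u N = applySubst φ (prefixOf u n) ++ List.replicate d 0)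
    (hj : L ≤ j) (he : e < (φ (u j)).length) (hea : e ≤ a) :
    stepTriple φ L d e (relParikh u (factorAt u j n), u j, factorAt u (j + n - L) (2 * L + 1)) =
      (relParikh u (factorAt u ((applySubst φ (prefixOf u j)).length + e) N),
        u ((applySubst φ (prefixOf u j)).length + e),
        factorAt u ((applySubst φ (prefixOf u j)).length + e + N - L) (2 * L + 1)) := by
  obtain ⟨i, hi⟩ : ∃ i, i = j + n - L := ⟨_, rfl⟩
  rw [← hi]
  have hin : i + L = j + n := by omega
  set s : ℕ → ℕ := fun i => (applySubst φ (prefixOf u i)).length with hs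
  have hV : applySubst φ (factorAt u i L) =
      factorAt u (s i) (applySubst φ (factorAt u i L)).length := hu.image_factorAt _ _
  have hW : applySubst φ (factorAt u i (2 * L + 1)) =
      factorAt u (s i) (applySubst φ (factorAt u i (2 * L + 1))).length := hu.image_factorAt _ _
  have hX : φ (u j) = factorAt u (s j) (φ (u j)).length := by
    have := hu.image_factorAt j 1
    rwa [factorAt_one, applySubst_singleton] at this
  have hlenV : s (j + n) = s i + (applySubst φ (factorAt u i L)).length := by
    simp only [hs, ← hin, prefixOf_add, applySubst_append, List.length_append]
  have hlenW : (applySubst φ (factorAt u i (2 * L + 1))).length =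
      (applySubst φ (factorAt u i L)).length +
        (applySubst φ (factorAt u (i + L) (L + 1))).length := by
    rw [show 2 * L + 1 = L + (L + 1) by ring, factorAt_add, applySubst_append, List.length_append]
  -- The bound is applied to the L letters before the old end and to the L + 1 letters from it on.
  -- Each image leaves room for the shift d + e - h and for the new half-window.
  have hb1 := hL (factorAt u i L) (factorAt_isFactor _ _ _) (by simp)
  have hb2 := hL (factorAt u (i + L) (L + 1)) (factorAt_isFactor _ _ _) (by simp)
  have hb3 := hH (factorAt u j n) (factorAt_isFactor _ _ _)
  have hvec := vecMul_relParikh hu j n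
  have hsum : ∑ l, Matrix.vecMul (relParikh u (factorAt u j n)) (incidence φ) l =
      (s (j + n) : ℤ) - s j - s n := by
    rw [hvec]
    simp only [Pi.sub_apply, Finset.sum_sub_distrib, sum_parikh, length_prefixOf, hs]
  have hNlen : N = s n + d := by
    have := congrArg List.length hN
    simpa using this
  rw [hsum, abs_le] at hb3
  simp only [length_factorAt] at hb1 hb2
  have htk : (factorAt u i (2 * L + 1)).take L = factorAt u i L := take_factorAt _ _ (by omega)
  simp only [stepTriple, htk, hsum]
  obtain ⟨q, hq⟩ : ∃ q : ℕ, q = (((applySubst φ (factorAt u i L)).length : ℤ) + d + e -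
      (s (j + n) - s j - s n)).toNat := ⟨_, rfl⟩
  rw [← hq]
  have hqL : L ≤ q := by omega
  have hqW : q + L + 1 ≤ (applySubst φ (factorAt u i (2 * L + 1))).length := by omega
  have hpos : s i + q = s j + e + N := by omega
  rw [hW, hV, hX]
  refine Prod.ext ?_ (Prod.ext ?_ ?_)
  · simp only
    rw [take_factorAt _ _ (by omega), take_factorAt _ _ he.le, hvec, parikh_factorAt,
      parikh_factorAt, parikh_factorAt, hpos, ← hlenV, relParikh_factorAt, hN, parikh_append,
      hu n]
    simp only [hs, length_prefixOf]
    abel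
  · exact getD_factorAt _ _ he _
  · simp only
    obtain ⟨t, ht⟩ := Nat.exists_eq_add_of_le (show q - L ≤
      (applySubst φ (factorAt u i (2 * L + 1))).length by omega)
    rw [ht, drop_factorAt, take_factorAt _ _ (by omega)]
    congr 1
    change s i + (q - L) = s j + e + N - L
    omega

/-- The images of the letters of u are nonempty, so consecutive blocks of these lengths tile all
positions. -/
theorem exists_position [NeZero K] {α : Fin K → ℕ} (h : IsParryLike α φ) (u : ℕ → Fin K) (J : ℕ) :
    ∃ j e, e < (φ (u j)).length ∧ J = (applySubst φ (prefixOf u j)).length + e := by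
  induction J with
  | zero =>
    exact ⟨0, 0, List.length_pos_of_ne_nil (h.ne_nil _), by simp [prefixOf, factorAt, applySubst]⟩
  | succ J ih =>
    obtain ⟨j, e, he, hJ⟩ := ih
    rcases Nat.lt_or_ge (e + 1) (φ (u j)).length with h1 | h1
    · exact ⟨j, e + 1, h1, by omega⟩
    · refine ⟨j + 1, 0, List.length_pos_of_ne_nil (h.ne_nil _), ?_⟩
      rw [prefixOf_add, applySubst_append, factorAt_one, applySubst_singleton, List.length_append]
      omega

/-- The triple that belongs to the factor of length `n` at position `j`. -/
def tripleAt (u : ℕ → Fin K) (L n j : ℕ) : Triple K :=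
  (relParikh u (factorAt u j n), u j, factorAt u (j + n - L) (2 * L + 1))

/-- The word u_{i-L} ⋯ u_{i+n+L} covers both the factor and the window around its end. -/
theorem tripleAt_eq_of_factorAt_eq {L n i j : ℕ} (hi : L ≤ i) (hj : L ≤ j)
    (hij : factorAt u (i - L) (L + (n + (L + 1))) = factorAt u (j - L) (L + (n + (L + 1)))) :
    tripleAt u L n i = tripleAt u L n j := by
  have h1 := congrArg (List.drop L) hij
  rw [drop_factorAt, drop_factorAt, Nat.sub_add_cancel hi, Nat.sub_add_cancel hj] at h1
  have h2 := congrArg (List.take n) h1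
  rw [take_factorAt _ _ (by omega), take_factorAt _ _ (by omega)] at h2
  have h3 := congrArg (List.take 1) h1
  rw [take_factorAt _ _ (by omega), take_factorAt _ _ (by omega), factorAt_one, factorAt_one,
    List.cons.injEq] at h3
  have h4 := congrArg (List.drop n) hij
  rw [show L + (n + (L + 1)) = n + (2 * L + 1) by ring, drop_factorAt, drop_factorAt,
    show i - L + n = i + n - L by omega, show j - L + n = j + n - L by omega] at h4
  rw [tripleAt, tripleAt, h2, h3.1, h4]

theorem exists_tripleAt_eq [NeZero K] {α : Fin K → ℕ} (h : IsParryLike α φ)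
    (hu : IsFixedPoint φ u) {L : ℕ} (n B : ℕ) {j : ℕ} (hj : L ≤ j) :
    ∃ i, B ≤ i ∧ L ≤ i ∧ tripleAt u L n i = tripleAt u L n j := by
  obtain ⟨i, hi, hi'⟩ := h.recurrent hu (j - L) (L + (n + (L + 1))) B
  refine ⟨i + L, by omega, by omega, tripleAt_eq_of_factorAt_eq (by omega) hj ?_⟩
  rwa [Nat.add_sub_cancel]

/-- The set `S(N)` is determined by `S(n)` and `d` if `⟨N⟩_U = ⟨n⟩_U d`. -/
theorem setS_eq_stepSet [NeZero K] {α : Fin K → ℕ} (h : IsParryLike α φ)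
    (hu : IsFixedPoint φ u) {H L : ℕ} (hH : IsBoundH φ u H) (hL : IsBoundL (α 0) φ u H L)
    {n N d : ℕ} (hN : 1 ≤ N)
    (hrep : normalRep (basis φ) N = normalRep (basis φ) n ++ [d]) :
    setS u L N = stepSet φ L d (setS u L n) := by
  obtain ⟨hd, hp⟩ := h.prefixOf_eq_of_normalRep hu hN hrep
  have hea : ∀ j e, e < (φ (u j)).length → e ≤ α 0 := fun j e he => by
    have := h.length_image_letter_le (u j)
    omega
  have hlen : ∀ j, j ≤ (applySubst φ (prefixOf u j)).length := fun j => by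
    have := h.length_le_image (prefixOf u j)
    rwa [length_prefixOf] at this
  ext y
  constructor
  · rintro ⟨J₀, hJ₀, rfl⟩
    -- The given occurrence may come from a letter u_j with j < L. Recurrence moves it past φ(u_0 ⋯
    -- u_{L-1}) without changing its triple.
    obtain ⟨J, hJB, hJL, hJ⟩ :=
      exists_tripleAt_eq h hu N (applySubst φ (prefixOf u L)).length hJ₀
    obtain ⟨j, e, he, rfl⟩ := exists_position h u J
    have hj : L ≤ j := by
      by_contra hlt
      obtain ⟨r, hr⟩ := Nat.exists_eq_add_of_lt (not_le.1 hlt)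
      have h1 : (applySubst φ (prefixOf u (j + 1))).length ≤
          (applySubst φ (prefixOf u L)).length := by
        rw [hr, show j + r + 1 = j + 1 + r by ring, prefixOf_add u (j + 1), applySubst_append,
          List.length_append]
        omega
      rw [prefixOf_add, applySubst_append, factorAt_one, applySubst_singleton,
        List.length_append] at h1
      omega
    refine ⟨tripleAt u L n j, ⟨j, hj, rfl⟩, e, he, ?_⟩
    exact hJ.symm.trans (stepTriple_eq hu hH hL hd hp hj he (hea j e he)).symm
  · rintro ⟨x, ⟨j, hj, rfl⟩, e, he, rfl⟩
    refine ⟨(applySubst φ (prefixOf u j)).length + e, ?_,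
      stepTriple_eq hu hH hL hd hp hj he (hea j e he)⟩
    have := hlen j
    omega

/-! ### Finiteness of the set of states and construction of the transitions -/

theorem finite_range_setS {c : ℕ} (hc : IsBalanced c u) (L : ℕ) :
    (Set.range (setS u L)).Finite := by
  have hT : ((Set.univ.pi fun _ : Fin K => Set.Icc (-(c : ℤ)) c) ×ˢ
      ((Set.univ : Set (Fin K)) ×ˢ {l : List (Fin K) | l.length = 2 * L + 1})).Finite :=
    (Set.Finite.pi fun _ => Set.finite_Icc _ _).prod
      (Set.finite_univ.prod (List.finite_length_eq _ _))
  refine hT.finite_subsets.subset ?_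
  rintro _ ⟨n, rfl⟩ _ ⟨j, -, rfl⟩
  refine ⟨fun i _ => ?_, Set.mem_univ _, by simp⟩
  exact abs_le.1 (abs_relParikh_le hc j n i)

/-- This lets state j ≥ 1 simply be S(j) for j up to a large M, so that S_d = S(d) for the digits d
≥ 1 holds automatically. -/
theorem exists_representatives {β : Type*} {f : ℕ → β} (hf : (Set.range f).Finite) :
    ∃ B, ∀ n, 1 ≤ n → ∃ n', 1 ≤ n' ∧ n' ≤ B ∧ f n = f n' := by
  have hf' : (f '' {n | 1 ≤ n}).Finite := hf.subset (Set.image_subset_range _ _)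
  have hex : ∀ y ∈ f '' {n | 1 ≤ n}, ∃ n, 1 ≤ n ∧ f n = y := fun y hy => hy
  choose! g hg using hex
  obtain ⟨B, hB⟩ := (hf'.image g).bddAbove
  refine ⟨B, fun n hn => ?_⟩
  have hy : f n ∈ f '' {n | 1 ≤ n} := ⟨n, hn, rfl⟩
  exact ⟨g (f n), (hg _ hy).1, hB ⟨_, hy, rfl⟩, (hg _ hy).2.symm⟩

/-- Existence of the sets `S_0, …, S_M` and the transition function. -/
theorem exists_isTransition [NeZero K] {α : Fin K → ℕ} (h : IsParryLike α φ)
    (hu : IsFixedPoint φ u) {c : ℕ} (hc : IsBalanced c u) {H L : ℕ} (hH : IsBoundH φ u H)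
    (hL : IsBoundL (α 0) φ u H L) :
    ∃ (M : ℕ) (S : Fin (M + 1) → Set (Triple K)) (δ : Fin (M + 1) → Fin (α 0 + 1) → Fin (M + 1)),
      IsTransition (α 0) φ u L M S δ := by
  classical
  obtain ⟨B, hB⟩ := exists_representatives (finite_range_setS hc L)
  have hα := h.zero_pos
  obtain ⟨M, hM, hBM⟩ : ∃ M, α 0 ≤ M ∧ B ≤ M := ⟨max (α 0) B, le_max_left _ _, le_max_right _ _⟩
  let S : Fin (M + 1) → Set (Triple K) := fun j => if j = 0 then ∅ else setS u L j
  have hcover : ∀ n, 1 ≤ n → ∃ j, j ≠ 0 ∧ setS u L n = S j := by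
    intro n hn
    obtain ⟨n', h1, h2, h3⟩ := hB n hn
    have hne : (⟨n', by omega⟩ : Fin (M + 1)) ≠ 0 := by
      rw [Ne, Fin.ext_iff]; simp; omega
    exact ⟨⟨n', by omega⟩, hne, by simp only [S, if_neg hne, h3]⟩
  have hδ : ∀ (j : Fin (M + 1)) (d : Fin (α 0 + 1)), ∃ j', j' ≠ 0 ∧ ∀ n N : ℕ, 1 ≤ n → 1 ≤ N →
      normalRep (basis φ) N = normalRep (basis φ) n ++ [(d : ℕ)] →
      setS u L n = S j → setS u L N = S j' := by
    intro j d
    by_cases hex : ∃ n N : ℕ, 1 ≤ n ∧ 1 ≤ N ∧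
      normalRep (basis φ) N = normalRep (basis φ) n ++ [(d : ℕ)] ∧ setS u L n = S j
    -- Any one realising pair determines the target, since S(N) depends only on the set S_j and on d
    -- through `stepSet`.
    · obtain ⟨n, N, -, hN, hrep, hS⟩ := hex
      obtain ⟨j', hj', hS'⟩ := hcover N hN
      refine ⟨j', hj', fun n₁ N₁ _ hN₁ hrep₁ hS₁ => ?_⟩
      rw [← hS', setS_eq_stepSet h hu hH hL hN hrep, setS_eq_stepSet h hu hH hL hN₁ hrep₁, hS, hS₁]
    -- A transition that never occurs still needs a nonzero target; M ≥ α_0 ≥ 1 makes the last state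
    -- one.
    · refine ⟨Fin.last M, ?_, fun n N h1 h2 h3 h4 => absurd ⟨n, N, h1, h2, h3, h4⟩ hex⟩
      rw [Ne, Fin.ext_iff]; simp; omega
  choose δ hδ0 hδS using hδ
  have hcast : ∀ d : Fin (α 0 + 1), d ≠ 0 →
      (Fin.castLE (Nat.succ_le_succ hM) d : Fin (M + 1)) ≠ 0 := by
    intro d hd
    rw [Ne, Fin.ext_iff] at hd ⊢
    simpa using hd
  refine ⟨M, S, fun j d => if j = 0 then Fin.castLE (Nat.succ_le_succ hM) d else δ j d,
    ⟨hM, by simp [S], hcover, ?_, ?_, ?_, ?_⟩⟩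
  · intro d hd
    simp only [S, if_neg (hcast d hd)]
    rfl
  · intro d _
    simp
  · intro j d hj
    simp only [if_neg hj]
    exact hδ0 j d
  · intro n N d j h1 h2 hj h3 h4
    simp only [if_neg hj]
    exact hδS j d n N h1 h2 h3 h4

end

/-! ### Output and running time of the automaton -/

section

variable {K : ℕ} [NeZero K] {α : Fin K → ℕ} {φ : Fin K → List (Fin K)} {u : ℕ → Fin K}

/-- The first components of the triples in `S(n)` account for the abelian complexity. -/
theorem abelianComplexity_eq_ncard (h : IsParryLike α φ) (hu : IsFixedPoint φ u) (L n : ℕ) :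
    abelianComplexity u n = {ψ | ∃ x ∈ setS u L n, ψ = x.1}.ncard := by
  have heq : {ψ : Fin K → ℤ | ∃ x ∈ setS u L n, ψ = x.1} = (fun ψ => ψ - parikh (prefixOf u n)) ''
      {ψ : Fin K → ℤ | ∃ w, IsFactor u w ∧ w.length = n ∧ ψ = parikh w} := by
    ext ψ
    constructor
    · rintro ⟨_, ⟨j, -, rfl⟩, rfl⟩
      exact ⟨_, ⟨_, factorAt_isFactor u j n, length_factorAt u j n, rfl⟩, by simp [relParikh]⟩
    · rintro ⟨_, ⟨w, ⟨j, hj⟩, rfl, rfl⟩, rfl⟩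
      obtain ⟨i, hi, hi'⟩ := h.recurrent hu j w.length L
      refine ⟨_, ⟨i, hi, rfl⟩, ?_⟩
      simp only [relParikh, hi', ← hj]
  rw [heq, abelianComplexity, Set.ncard_image_of_injective _ sub_left_injective]

theorem DFAO.output_eq {Sig Del : Type} (A : DFAO Sig Del) (w : List Sig) :
    A.output w = A.τ (w.foldl A.δ A.q₀) := by
  have : ∀ q, (A.runFrom q w).1 = A.τ (w.foldl A.δ q) := by
    induction w with
    | nil => exact fun q => rfl
    | cons d w ih => exact fun q => ih _
  exact this _

theorem DFAO.steps_eq {Sig Del : Type} (A : DFAO Sig Del) (w : List Sig) :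
    A.steps w = w.length + 1 := by
  have : ∀ q, (A.runFrom q w).2 = w.length + 1 := by
    induction w with
    | nil => exact fun q => rfl
    | cons d w ih => exact fun q => by rw [DFAO.runFrom, ih, List.length_cons]
  exact this _

theorem isNormalRep_iff {U : ℕ → ℕ} {a n : ℕ} {w : List (Fin (a + 1))} :
    IsNormalRep U n w ↔ w.map Fin.val = normalRep U n := by
  simp [IsNormalRep, List.map_eq_flatMap]

/-- After reading `⟨n⟩_U` the automaton is in a state `j` with `S_j = S(n)`. -/
theorem exists_normalRep_deltaStar (h : IsParryLike α φ) (hu : IsFixedPoint φ u) {L M : ℕ}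
    {S : Fin (M + 1) → Set (Triple K)} {δ : Fin (M + 1) → Fin (α 0 + 1) → Fin (M + 1)}
    (hT : IsTransition (α 0) φ u L M S δ) {n : ℕ} (hn : 1 ≤ n) :
    ∃ w : List (Fin (α 0 + 1)), IsNormalRep (basis φ) n w ∧ deltaStar δ 0 w ≠ 0 ∧
      setS u L n = S (deltaStar δ 0 w) := by
  induction n using Nat.strong_induction_on with
  | _ N ih =>
    obtain ⟨n, d, hnN, hd, hrep, hp⟩ := h.exists_normalRep_eq_append hu hn
    -- One-digit representations leave the initial state by `start`; longer ones use `step`, which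
    -- requires the state reached so far to be nonzero.
    rcases Nat.eq_zero_or_pos n with rfl | hpos
    · have hNd : N = d := by
        have := congrArg List.length hp
        simpa [prefixOf, factorAt, applySubst] using this
      subst hNd
      have hne : (⟨N, by omega⟩ : Fin (α 0 + 1)) ≠ 0 := by
        rw [Ne, Fin.ext_iff]; simp; omega
      have hrun : deltaStar δ 0 [⟨N, by omega⟩] =
          Fin.castLE (Nat.succ_le_succ hT.le) (⟨N, by omega⟩ : Fin (α 0 + 1)) := hT.start _ hne
      refine ⟨[⟨N, by omega⟩], ?_, ?_, ?_⟩
      · rw [isNormalRep_iff, hrep]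
        simp [normalRep]
      · rw [hrun, Ne, Fin.ext_iff]
        simp; omega
      · rw [hrun, hT.digit _ hne]
    · obtain ⟨w, hw, hw0, hwS⟩ := ih n hnN hpos
      have hrun : deltaStar δ 0 (w ++ [⟨d, by omega⟩]) = δ (deltaStar δ 0 w) ⟨d, by omega⟩ := by
        simp [deltaStar]
      refine ⟨w ++ [⟨d, by omega⟩], ?_, ?_, ?_⟩
      · rw [isNormalRep_iff] at hw ⊢
        rw [hrep, List.map_append, hw]
        rfl
      · rw [hrun]
        exact hT.ne_zero _ _ hw0
      · rw [hrun]
        exact hT.step n N ⟨d, by omega⟩ _ hpos hn hw0 hrep hwS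

theorem exists_output_eq (h : IsParryLike α φ) (hu : IsFixedPoint φ u) {L M : ℕ}
    {S : Fin (M + 1) → Set (Triple K)} {δ : Fin (M + 1) → Fin (α 0 + 1) → Fin (M + 1)}
    (hT : IsTransition (α 0) φ u L M S δ) {n : ℕ} (hn : 1 ≤ n) :
    ∃ w : List (Fin (α 0 + 1)), IsNormalRep (basis φ) n w ∧
      abelianComplexity u n = tau S (deltaStar δ 0 w) ∧
      abelianComplexity u n = (abelianDFAO S δ).output w := by
  obtain ⟨w, hw, -, hS⟩ := exists_normalRep_deltaStar h hu hT hn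
  have key : abelianComplexity u n = tau S (deltaStar δ 0 w) := by
    rw [abelianComplexity_eq_ncard h hu L, hS]
    rfl
  exact ⟨w, hw, key, by rw [key, DFAO.output_eq]; rfl⟩

/-! ### Growth of the basis -/

theorem count_mul_basis_le (j : ℕ) (w : List (Fin K)) :
    w.count 0 * basis φ j ≤ ((applySubst φ)^[j] w).length := by
  induction w with
  | nil => simp
  | cons a w ih =>
    rw [← List.singleton_append, iterate_applySubst_append, List.length_append, List.count_append,
      Nat.add_mul]
    refine Nat.add_le_add ?_ ih
    by_cases ha : a = 0
    · subst ha
      simp [basis]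
    · simp [ha]

/-- For suitable p, φ^p(0) contains two zeros, so φ^{j+p}(0) contains two copies of φ^j(0). -/
theorem exists_two_mul_basis_le (h : IsParryLike α φ) (hu : IsFixedPoint φ u) :
    ∃ p, ∀ j, 2 * basis φ j ≤ basis φ (j + p) := by
  obtain ⟨p, hp⟩ := h.exists_count_zero_ge hu 2
  refine ⟨p, fun j => ?_⟩
  have h1 := hp (basis φ p) h.basis_strictMono.le_apply
  have h2 := count_mul_basis_le (φ := φ) j (prefixOf u (basis φ p))
  rw [← h.iterate_zero_eq_prefixOf hu, ← Function.iterate_add_apply] at h2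
  rw [← h.iterate_zero_eq_prefixOf hu] at h1
  exact (Nat.mul_le_mul_right _ h1).trans h2

theorem exists_length_normalRep_le (h : IsParryLike α φ) (hu : IsFixedPoint φ u) :
    ∃ C : ℝ, ∀ n : ℕ, 2 ≤ n → ((normalRep (basis φ) n).length + 1 : ℝ) ≤ C * Real.log n := by
  obtain ⟨p, hp⟩ := exists_two_mul_basis_le h hu
  have hpow : ∀ q, 2 ^ q ≤ basis φ (q * p) := by
    intro q
    induction q with
    | zero => simp [basis_zero]
    | succ q ih =>
      have := hp (q * p)
      rw [Nat.succ_mul, pow_succ]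
      omega
  have hp0 : 0 < p := by
    rcases Nat.eq_zero_or_pos p with rfl | h0
    · have := hp 0
      simp [basis_zero] at this
    · exact h0
  have hlog2 : 0 < Real.log 2 := Real.log_pos (by norm_num)
  -- With leading position k, the left side is k + 2 ≤ p⌊k/p⌋ + p + 2. After multiplication by log
  -- 2, the first term is at most p log n and the rest at most (p + 2) log n, using n ≥ 2.
  refine ⟨(2 * p + 2) / Real.log 2, fun n hn => ?_⟩
  obtain ⟨k, hk, hk'⟩ := exists_basis_le_lt h.basis_strictMono basis_zero (show 1 ≤ n by omega)
  rw [normalRep_eq_lowDigits h.basis_strictMono hk hk' (by omega), length_lowDigits]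
  have h1 : 2 ^ (k / p) ≤ n :=
    (hpow _).trans ((h.basis_strictMono.monotone (Nat.div_mul_le_self k p)).trans hk)
  have h2 : ((k / p : ℕ) : ℝ) * Real.log 2 ≤ Real.log n := by
    rw [← Real.log_pow]
    exact Real.log_le_log (by positivity) (by exact_mod_cast h1)
  have h3 : Real.log 2 ≤ Real.log n := Real.log_le_log (by norm_num) (by exact_mod_cast hn)
  have h4 : (k : ℝ) ≤ p * (k / p : ℕ) + p := by
    have := (Nat.lt_mul_div_succ k hp0).le
    rw [Nat.mul_add, Nat.mul_one] at this
    exact_mod_cast this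
  rw [div_mul_eq_mul_div, le_div_iff₀ hlog2]
  push_cast
  have hpR : (0 : ℝ) ≤ p := Nat.cast_nonneg p
  have h5 := mul_le_mul_of_nonneg_right h4 hlog2.le
  have h6 := mul_le_mul_of_nonneg_left h2 hpR
  have h7 := mul_le_mul_of_nonneg_left h3 (show (0 : ℝ) ≤ p + 2 by positivity)
  linarith

end

end Parry

theorem theorem1 {K : ℕ} [NeZero K] (α : Fin K → ℕ) (φ : Fin K → List (Fin K))
    (hφ : IsParrySubst α φ) (u : ℕ → Fin K) (hu : IsFixedPoint φ u)
    (c : ℕ) (hc : IsBalanced c u) :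
    (∃ H L : ℕ, IsBoundH φ u H ∧ IsBoundL (α 0) φ u H L) ∧
    (∀ H L : ℕ, IsBoundH φ u H → IsBoundL (α 0) φ u H L →
      (∃ (M : ℕ) (S : Fin (M + 1) → Set (Triple K))
        (δ : Fin (M + 1) → Fin (α 0 + 1) → Fin (M + 1)),
        IsTransition (α 0) φ u L M S δ) ∧
      (∀ (M : ℕ) (S : Fin (M + 1) → Set (Triple K))
        (δ : Fin (M + 1) → Fin (α 0 + 1) → Fin (M + 1)),
        IsTransition (α 0) φ u L M S δ →
        (∀ n : ℕ, 1 ≤ n → ∃ w : List (Fin (α 0 + 1)), IsNormalRep (basis φ) n w ∧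
          abelianComplexity u n = tau S (deltaStar δ 0 w) ∧
          abelianComplexity u n = (abelianDFAO S δ).output w) ∧
        (∃ C : ℝ, ∀ n : ℕ, 2 ≤ n → ∀ w : List (Fin (α 0 + 1)), IsNormalRep (basis φ) n w →
          ((abelianDFAO S δ).steps w : ℝ) ≤ C * Real.log n))) ∧
    IsUAutomatic (basis φ) (α 0) (abelianComplexity u) := by
  have h := hφ.isParryLike
  obtain ⟨H, hH⟩ := exists_isBoundH (φ := φ) hc
  obtain ⟨L, hL⟩ := h.exists_isBoundL hu hc H
  refine ⟨⟨H, L, hH, hL⟩, fun H L hH hL => ⟨exists_isTransition h hu hc hH hL,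
    fun M S δ hT => ⟨fun n hn => exists_output_eq h hu hT hn, ?_⟩⟩, ?_⟩
  · obtain ⟨C, hC⟩ := exists_length_normalRep_le h hu
    refine ⟨C, fun n hn w hw => ?_⟩
    rw [DFAO.steps_eq, ← List.length_map Fin.val, isNormalRep_iff.1 hw]
    exact_mod_cast hC n hn
  · obtain ⟨M, S, δ, hT⟩ := exists_isTransition h hu hc hH hL
    -- The values of `tau S` on the finitely many states form the finite output alphabet.
    let A : DFAO (Fin (α 0 + 1)) (Finset.univ.image (tau S) : Finset ℕ) :=
      { Q := Fin (M + 1)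
        finite := inferInstance
        δ := δ
        q₀ := 0
        τ := fun j => ⟨tau S j, Finset.mem_image_of_mem _ (Finset.mem_univ j)⟩ }
    refine ⟨_, A, fun n hn => ?_⟩
    obtain ⟨w, hw, hτ, -⟩ := exists_output_eq h hu hT hn
    exact ⟨w, hw, by rw [hτ, DFAO.output_eq]; rfl⟩
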